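/- Let $A \in \mathbb{R}^{n\times n}$ and $q \in \mathbb{R}^n$. Call $A$ a $Z$-matrix if all its off-diagonal entries are $\le 0$; a hidden $Z$-matrix if there are $Z$-matrices $X, Y \in \mathbb{R}^{n\times n}$ and vectors $r, s \in \mathbb{R}^n$, $r, s \ge 0$, with $AX = Y$ and $r^TX + s^TY > 0$ (componentwise); and an $E_0$-matrix if for every $x \ge 0$, $x \ne 0$, there is an index $k$ with $x_k > 0$ and $(Ax)_k \ge 0$. Let $\mathrm{FEA}(q,A) = \{z \in \mathbb{R}^n : z \ge 0,\ q + Az \ge 0\}$, and let the solutions of $\mathrm{LCP}(q,A)$ be the $z \in \mathrm{FEA}(q,A)$ with $z^T(q + Az) = 0$; such a solution $z$ is non-degenerate if $z_i + (q + Az)_i > 0$ for all $i$. A basis of $\mathrm{FEA}(q,A)$ is a set of columns (given by their indices) of $[\,I,\,-A\,]$, the coefficient matrix of the system $w - Az = q$, that forms a basis of $\mathbb{R}^n$; its basic solution is the unique $(w,z)$ with $w - Az = q$ whose non-basic variables are zero; the basis is feasible if its basic solution is $\ge 0$, and non-degenerate if no basic variable of its basic solution is zero. **Theorem.** Let $A$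 be a hidden $Z$-matrix that is also an $E_0$-matrix. Suppose that every feasible basis of $\mathrm{FEA}(q,A)$ is non-degenerate and that $\mathrm{LCP}(q,A)$ has a solution. Then $\mathrm{LCP}(q,A)$ has exactly one solution, and this solution is non-degenerate. -/

import Mathlib

namespace LCP

open Matrix

/-- A `Z`-matrix: all off-diagonal entries are non-positive. -/
def IsZMatrix {n : ℕ} (A : Matrix (Fin n) (Fin n) ℝ) : Prop :=
  ∀ i j, i ≠ j → A i j ≤ 0

/-- A hidden `Z`-matrix: there are `Z`-matrices `X`, `Y` and vectors `r, s ≥ 0` with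
`A X = Y` and `rᵀ X + sᵀ Y > 0` (componentwise). -/
def IsHiddenZ {n : ℕ} (A : Matrix (Fin n) (Fin n) ℝ) : Prop :=
  ∃ (X Y : Matrix (Fin n) (Fin n) ℝ) (r s : Fin n → ℝ),
    IsZMatrix X ∧ IsZMatrix Y ∧ 0 ≤ r ∧ 0 ≤ s ∧ A * X = Y ∧
      ∀ j, 0 < (r ᵥ* X + s ᵥ* Y) j

/-- An `E₀`-matrix: every `0 ≠ x ≥ 0` has an index `k` with `x_k > 0` and `(A x)_k ≥ 0`. -/
def IsE0 {n : ℕ} (A : Matrix (Fin n) (Fin n) ℝ) : Prop :=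
  ∀ x : Fin n → ℝ, x ≠ 0 → 0 ≤ x → ∃ k, 0 < x k ∧ 0 ≤ (A *ᵥ x) k

/-- The feasible set `FEA(q, A)`. -/
def FEA {n : ℕ} (q : Fin n → ℝ) (A : Matrix (Fin n) (Fin n) ℝ) : Set (Fin n → ℝ) :=
  {z | 0 ≤ z ∧ 0 ≤ q + A *ᵥ z}

/-- The solution set `SOL(q, A)` of the linear complementarity problem. -/
def SOL {n : ℕ} (q : Fin n → ℝ) (A : Matrix (Fin n) (Fin n) ℝ) : Set (Fin n → ℝ) :=
  {z | z ∈ FEA q A ∧ z ⬝ᵥ (q + A *ᵥ z) = 0}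

/-- Strict complementarity: with `w = q + A z`, one has `z_i + w_i > 0` for every `i`. -/
def IsNondegenerateAt {n : ℕ} (q : Fin n → ℝ) (A : Matrix (Fin n) (Fin n) ℝ)
    (z : Fin n → ℝ) : Prop :=
  ∀ i, 0 < z i + (q + A *ᵥ z) i

/-- The coefficient matrix `[I, -A]` of the system `w - A z = q`, `w, z ≥ 0`, which is
`FEA(q, A)` written with the slack vector `w`. The column `Sum.inl i` belongs to `w_i`, the
column `Sum.inr i` to `z_i`. -/
def slackMatrix {n : ℕ} (A : Matrix (Fin n) (Fin n) ℝ) :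
    Matrix (Fin n) (Fin n ⊕ Fin n) ℝ :=
  Matrix.fromCols 1 (-A)

/-- `B` indexes columns of `[I, -A]` that form a basis of `ℝⁿ`. -/
def IsBasis {n : ℕ} (A : Matrix (Fin n) (Fin n) ℝ) (B : Set (Fin n ⊕ Fin n)) : Prop :=
  LinearIndepOn ℝ (slackMatrix A).col B ∧
    Submodule.span ℝ ((slackMatrix A).col '' B) = ⊤

/-- `x = (w, z)` satisfies `w - A z = q` and its non-basic variables vanish.
For a basis `B` there is exactly one such `x`. -/
def IsBasicSolution {n : ℕ} (q : Fin n → ℝ) (A : Matrix (Fin n) (Fin n) ℝ)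
    (B : Set (Fin n ⊕ Fin n)) (x : Fin n ⊕ Fin n → ℝ) : Prop :=
  slackMatrix A *ᵥ x = q ∧ ∀ j, j ∉ B → x j = 0

/-- A feasible basis of `FEA(q, A)`: a basis whose basic solution is nonnegative. -/
def IsFeasibleBasis {n : ℕ} (q : Fin n → ℝ) (A : Matrix (Fin n) (Fin n) ℝ)
    (B : Set (Fin n ⊕ Fin n)) : Prop :=
  IsBasis A B ∧ ∃ x, IsBasicSolution q A B x ∧ 0 ≤ x

/-- A non-degenerate basis: in its basic solution no basic variable vanishes. -/
def IsNondegenerateBasis {n : ℕ} (q : Fin n → ℝ) (A : Matrix (Fin n) (Fin n) ℝ)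
    (B : Set (Fin n ⊕ Fin n)) : Prop :=
  IsBasis A B ∧ ∃ x, IsBasicSolution q A B x ∧ ∀ j ∈ B, x j ≠ 0

end LCP

namespace LCP

open Matrix

variable {n : ℕ}

/-! Replacing `A` by `A + εI` turns `E₀` into strict semimonotonicity and, for small `ε > 0`, keeps
the hidden `Z` property. For such a matrix `M` with `M X = Y`, minimal points of polyhedra cut out
by `X` and `Y` are complementary. This makes `X` inverse-nonnegative and gives `p > 0` with `X p, Y
p > 0`. Hence `M` reverses the sign of no nonzero vector, and its LCP has at most one solution
(`IsHiddenZ.eq_of_mem_SOL`).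

Non-degeneracy of the feasible bases makes each solution of `LCP(q, A)` strictly complementary with
a nonsingular basis, so it persists, with its support, under the perturbation
(`eventually_exists_mem_SOL`). Two solutions thus perturb to the same one, share a support and hence
a basis, and coincide. -/

/-! ### `Z`-matrices and minimal points -/

/-- Lowering the coordinate `i` of `v` does not decrease the other rows of `X v`. -/
lemma IsZMatrix.mulVec_le_mulVec_sub_single {X : Matrix (Fin n) (Fin n) ℝ} (hX : IsZMatrix X)
    (v : Fin n → ℝ) {i j : Fin n} (hij : j ≠ i) {δ : ℝ} (hδ : 0 ≤ δ) :
    (X *ᵥ v) j ≤ (X *ᵥ (v - Pi.single i δ)) j := by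
  have h := mul_nonpos_of_nonpos_of_nonneg (hX j i hij) hδ
  simp [mulVec_sub]
  linarith

/-- A `Z`-matrix has nonpositive rows at the zeros of a nonnegative vector. -/
lemma IsZMatrix.mulVec_nonpos {X : Matrix (Fin n) (Fin n) ℝ} (hX : IsZMatrix X)
    {v : Fin n → ℝ} (hv : 0 ≤ v) {i : Fin n} (hi : v i = 0) : (X *ᵥ v) i ≤ 0 := by
  change ∑ j, X i j * v j ≤ 0
  refine Finset.sum_nonpos fun j _ => ?_
  by_cases hij : i = j
  · subst hij; simp [hi]
  · exact mul_nonpos_of_nonpos_of_nonneg (hX i j hij) (hv j)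

/-- Such polyhedra are closed under meets: in row `i`, compare `v ⊓ 0` with whichever of `v` and `0`
agrees with it at `i`. -/
lemma IsZMatrix.le_mulVec_inf_zero {X : Matrix (Fin n) (Fin n) ℝ} (hX : IsZMatrix X)
    {v a : Fin n → ℝ} (ha : a ≤ 0) (hv : a ≤ X *ᵥ v) : a ≤ X *ᵥ (v ⊓ 0) := by
  intro i
  rcases le_total (v i) 0 with hi | hi
  · have h : (X *ᵥ (v - v ⊓ 0)) i ≤ 0 :=
      hX.mulVec_nonpos (sub_nonneg.2 inf_le_left) (by simp [hi])
    rw [mulVec_sub, Pi.sub_apply] at h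
    linarith [hv i]
  · have h : (X *ᵥ (-(v ⊓ 0))) i ≤ 0 :=
      hX.mulVec_nonpos (neg_nonneg.2 inf_le_right) (by simp [hi])
    rw [mulVec_neg, Pi.neg_apply] at h
    have := ha i
    simp only [Pi.zero_apply] at this
    linarith

/-- A minimal point of a polyhedron `X v ≥ a`, `(Y v)_β ≥ b_β` given by `Z`-matrices is
complementary. -/
lemma exists_complementary {X Y : Matrix (Fin n) (Fin n) ℝ} (hX : IsZMatrix X)
    (hY : IsZMatrix Y) (β : Set (Fin n)) (a b l : Fin n → ℝ)
    (hl : ∀ v, a ≤ X *ᵥ v → (∀ i ∈ β, b i ≤ (Y *ᵥ v) i) → l ≤ v)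
    {v₀ : Fin n → ℝ} (hX₀ : a ≤ X *ᵥ v₀) (hY₀ : ∀ i ∈ β, b i ≤ (Y *ᵥ v₀) i) :
    ∃ m, m ≤ v₀ ∧ a ≤ X *ᵥ m ∧ (∀ i ∈ β, b i ≤ (Y *ᵥ m) i) ∧
      ∀ i, (X *ᵥ m) i = a i ∨ (i ∈ β ∧ (Y *ᵥ m) i = b i) := by
  set S : Set (Fin n → ℝ) :=
    {v | a ≤ X *ᵥ v} ∩ ⋂ i ∈ β, {v | b i ≤ (Y *ᵥ v) i} with hS
  have memS : ∀ v, v ∈ S ↔ a ≤ X *ᵥ v ∧ ∀ i ∈ β, b i ≤ (Y *ᵥ v) i := by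
    intro v; simp [hS]
  have hSc : IsClosed S := by
    have hc : ∀ Z : Matrix (Fin n) (Fin n) ℝ, Continuous fun v => Z *ᵥ v := fun Z => by fun_prop
    exact (isClosed_le continuous_const (hc X)).inter (isClosed_biInter fun i _ =>
      isClosed_le continuous_const ((continuous_apply i).comp (hc Y)))
  have hK : IsCompact (Set.Icc l v₀ ∩ S) := isCompact_Icc.inter_right hSc
  obtain ⟨m, ⟨hm, hmS⟩, hmin⟩ := hK.exists_isMinOn
    ⟨v₀, ⟨hl v₀ hX₀ hY₀, le_rfl⟩, (memS _).2 ⟨hX₀, hY₀⟩⟩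
    (f := fun v => ∑ i, v i) (by fun_prop)
  obtain ⟨hmX, hmY⟩ := (memS m).1 hmS
  refine ⟨m, hm.2, hmX, hmY, fun i => ?_⟩
  -- If both constraints at `i` were slack, `m i` could be lowered slightly: the other rows only
  -- grow, and the coordinate sum drops below its minimum.
  by_contra! hcon
  obtain ⟨h1, h2⟩ := hcon
  have h1' : a i < (X *ᵥ m) i := lt_of_le_of_ne (hmX i) (Ne.symm h1)
  have h2' : i ∈ β → b i < (Y *ᵥ m) i := fun hi => lt_of_le_of_ne (hmY i hi) (Ne.symm (h2 hi))
  have key : ∀ (Z : Matrix (Fin n) (Fin n) ℝ) (c : ℝ), c < (Z *ᵥ m) i →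
      ∀ᶠ δ in nhdsWithin (0 : ℝ) (Set.Ioi 0), c < (Z *ᵥ (m - Pi.single i δ)) i := by
    intro Z c hc
    have hcont : Continuous fun δ : ℝ => (Z *ᵥ (m - Pi.single i δ)) i := by
      simp only [mulVec_sub, Pi.sub_apply, mulVec_single]
      simp
      fun_prop
    exact ((hcont.tendsto 0).eventually_const_lt (by simpa using hc)).filter_mono
      nhdsWithin_le_nhds
  have hYe : ∀ᶠ δ in nhdsWithin (0 : ℝ) (Set.Ioi 0),
      i ∈ β → b i < (Y *ᵥ (m - Pi.single i δ)) i := by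
    by_cases hi : i ∈ β
    · filter_upwards [key Y _ (h2' hi)] with δ h _ using h
    · simp [hi]
  obtain ⟨δ, ⟨hδX, hδY⟩, hδ⟩ :=
    (((key X _ h1').and hYe).and self_mem_nhdsWithin).exists
  have hδ : 0 < δ := hδ
  have hX' : a ≤ X *ᵥ (m - Pi.single i δ) := by
    intro j
    by_cases hj : j = i
    · subst hj; exact hδX.le
    · exact (hmX j).trans (hX.mulVec_le_mulVec_sub_single m hj hδ.le)
  have hY' : ∀ j ∈ β, b j ≤ (Y *ᵥ (m - Pi.single i δ)) j := by
    intro j hjβ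
    by_cases hj : j = i
    · subst hj; exact (hδY hjβ).le
    · exact (hmY j hjβ).trans (hY.mulVec_le_mulVec_sub_single m hj hδ.le)
  have hle : m - Pi.single i δ ≤ v₀ := by
    refine le_trans ?_ hm.2
    rw [sub_le_self_iff]
    exact Pi.single_nonneg.2 hδ.le
  have := hmin (show _ ∈ Set.Icc l v₀ ∩ S from ⟨⟨hl _ hX' hY', hle⟩, (memS _).2 ⟨hX', hY'⟩⟩)
  simp [Finset.sum_sub_distrib] at this
  linarith

/-! ### Strictly semimonotone hidden `Z`-matrices -/

/-- Strictly semimonotone matrices. -/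
def IsStrictE (M : Matrix (Fin n) (Fin n) ℝ) : Prop :=
  ∀ x : Fin n → ℝ, x ≠ 0 → 0 ≤ x → ∃ k, 0 < x k ∧ 0 < (M *ᵥ x) k

lemma IsE0.isStrictE_add_smul_one {A : Matrix (Fin n) (Fin n) ℝ} (hA : IsE0 A) {ε : ℝ}
    (hε : 0 < ε) : IsStrictE (A + ε • 1) := by
  intro x hx hx0
  obtain ⟨k, hk, hAk⟩ := hA x hx hx0
  refine ⟨k, hk, ?_⟩
  simp [add_mulVec, smul_mulVec]
  positivity

/-- The witness `X` is kept and `Y` becomes `Y + εX`; the strict inequality survives for small `ε`.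
-/
lemma IsHiddenZ.eventually_add_smul_one {A : Matrix (Fin n) (Fin n) ℝ} (hA : IsHiddenZ A) :
    ∀ᶠ ε in nhdsWithin (0 : ℝ) (Set.Ioi 0), IsHiddenZ (A + ε • 1) := by
  obtain ⟨X, Y, r, s, hX, hY, hr, hs, hXY, ht⟩ := hA
  have h : ∀ᶠ ε in nhdsWithin (0 : ℝ) (Set.Ioi 0),
      ∀ j, 0 < (r ᵥ* X + s ᵥ* (Y + ε • X)) j := by
    refine Filter.eventually_all.2 fun j => ?_
    have hc : Continuous fun ε : ℝ => (r ᵥ* X + s ᵥ* (Y + ε • X)) j :=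
      (continuous_apply j).comp (by fun_prop)
    exact ((hc.tendsto 0).eventually_const_lt (by simpa using ht j)).filter_mono
      nhdsWithin_le_nhds
  filter_upwards [h, self_mem_nhdsWithin] with ε hε hpos
  have hpos : 0 < ε := hpos
  refine ⟨X, Y + ε • X, r, s, hX, fun i j hij => ?_, hr, hs, ?_, hε⟩
  · have := mul_nonpos_of_nonneg_of_nonpos hpos.le (hX i j hij)
    simp
    linarith [hY i j hij]
  · simp [add_mul, hXY]

/-- The matrix `X` of a strictly semimonotone hidden `Z`-matrix is inverse-nonnegative. -/
lemma IsStrictE.nonneg_of_mulVec_nonneg {X Y M : Matrix (Fin n) (Fin n) ℝ} {r s : Fin n → ℝ}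
    (hM : IsStrictE M) (hX : IsZMatrix X) (hY : IsZMatrix Y) (hr : 0 ≤ r) (hs : 0 ≤ s)
    (hXY : M * X = Y) (ht : ∀ j, 0 < (r ᵥ* X + s ᵥ* Y) j) {v : Fin n → ℝ}
    (hv : 0 ≤ X *ᵥ v) : 0 ≤ v := by
  have inner : ∀ u, (r ᵥ* X + s ᵥ* Y) ⬝ᵥ u = r ⬝ᵥ (X *ᵥ u) + s ⬝ᵥ (Y *ᵥ u) := by
    intro u; rw [add_dotProduct, dotProduct_mulVec, dotProduct_mulVec]
  set t := r ᵥ* X + s ᵥ* Y with htdef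
  -- The bound `-c` admits `v` itself and is strictly negative, so an active `Y`-row contradicts
  -- semimonotonicity below.
  obtain ⟨c, hc, hcv⟩ : ∃ c : ℝ, 0 < c ∧ ∀ i, -c ≤ (Y *ᵥ v) i := by
    refine ⟨1 + ∑ i, |(Y *ᵥ v) i|, by positivity, fun i => ?_⟩
    have := Finset.single_le_sum (fun j _ => abs_nonneg ((Y *ᵥ v) j)) (Finset.mem_univ i)
    linarith [neg_abs_le ((Y *ᵥ v) i)]
  -- All terms of `t ⬝ᵥ (u ⊓ 0)` are nonpositive, so a lower bound on the sum bounds each of them.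
  have hlow : ∀ u, 0 ≤ X *ᵥ u → (fun _ => -c) ≤ Y *ᵥ u → ∀ i,
      -(c * ∑ k, s k) ≤ t i * (u ⊓ 0) i := by
    intro u hu hu' i
    have h1 := hX.le_mulVec_inf_zero le_rfl hu
    have h2 := hY.le_mulVec_inf_zero (fun _ => by simpa using hc.le) hu'
    have h3 : t ⬝ᵥ (u ⊓ 0) ≤ t i * (u ⊓ 0) i := by
      have h4 := Finset.single_le_sum (f := fun j => -(t j * (u ⊓ 0) j)) (fun j _ => by
        have : (u ⊓ 0) j ≤ 0 := inf_le_right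
        have := mul_nonpos_of_nonneg_of_nonpos (ht j).le this
        linarith) (Finset.mem_univ i)
      rw [Finset.sum_neg_distrib] at h4
      simp only [dotProduct]
      linarith
    have h5 : 0 ≤ r ⬝ᵥ (X *ᵥ (u ⊓ 0)) := dotProduct_nonneg_of_nonneg hr h1
    have h6 : -(c * ∑ k, s k) ≤ s ⬝ᵥ (Y *ᵥ (u ⊓ 0)) := by
      calc -(c * ∑ k, s k) = ∑ k, s k * (-c) := by rw [← Finset.sum_mul]; ring
        _ ≤ _ := Finset.sum_le_sum fun k _ => mul_le_mul_of_nonneg_left (h2 k) (hs k)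
    linarith [inner (u ⊓ 0)]
  have hl : ∀ u, 0 ≤ X *ᵥ u → (∀ i ∈ Set.univ, -c ≤ (Y *ᵥ u) i) →
      (fun i => -(c * ∑ k, s k) / t i) ≤ u := by
    intro u hu hu' i
    have h1 := hlow u hu (fun i => hu' i trivial) i
    have h2 : (u ⊓ 0) i ≤ u i := inf_le_left
    rw [div_le_iff₀ (ht i)]
    nlinarith [ht i]
  obtain ⟨m, hmv, hmX, -, hcomp⟩ := exists_complementary hX hY Set.univ 0 (fun _ => -c) _ hl hv
    (fun i _ => hcv i)
  have hYX : ∀ u, M *ᵥ (X *ᵥ u) = Y *ᵥ u := fun u => by rw [mulVec_mulVec, hXY]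
  have hx0 : X *ᵥ m = 0 := by
    by_contra hne
    obtain ⟨k, hk, hMk⟩ := hM _ hne hmX
    rw [hYX] at hMk
    rcases hcomp k with h | ⟨-, h⟩
    · simp [h] at hk
    · linarith
  have hy0 : Y *ᵥ m = 0 := by rw [← hYX, hx0, mulVec_zero]
  have h1 := hX.le_mulVec_inf_zero le_rfl hmX
  have h2 := hY.le_mulVec_inf_zero le_rfl hy0.ge
  have h3 : 0 ≤ t ⬝ᵥ (m ⊓ 0) := by
    rw [inner]
    exact add_nonneg (dotProduct_nonneg_of_nonneg hr h1) (dotProduct_nonneg_of_nonneg hs h2)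
  intro i
  refine le_trans ?_ (hmv i)
  by_contra! hneg
  refine absurd h3 (not_le.2 (Finset.sum_neg' (fun j _ =>
    mul_nonpos_of_nonneg_of_nonpos (ht j).le inf_le_right) ⟨i, Finset.mem_univ _, ?_⟩))
  refine mul_neg_of_pos_of_neg (ht i) ?_
  simpa using hneg

/-- The two `Z`-matrices of a strictly semimonotone hidden `Z`-matrix are `M`-matrices with a
common positivity vector. -/
lemma IsStrictE.exists_mulVec_pos {X Y M : Matrix (Fin n) (Fin n) ℝ}
    (hM : IsStrictE M) (hX : IsZMatrix X) (hY : IsZMatrix Y) (hXY : M * X = Y)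
    (hXs : Function.Surjective X.mulVec) (hX0 : ∀ v, 0 ≤ X *ᵥ v → 0 ≤ v)
    (β : Finset (Fin n)) :
    ∃ p, (∀ i, 0 < (X *ᵥ p) i) ∧ ∀ i ∈ β, 0 < (Y *ᵥ p) i := by
  induction β using Finset.induction_on with
  | empty =>
    obtain ⟨p, hp⟩ := hXs 1
    exact ⟨p, fun i => by simp [hp], by simp⟩
  | insert i β hi ih =>
    obtain ⟨p, hpX, hpY⟩ := ih
    -- The right-hand side `Pi.single i _` forces `X m ≠ 0`. By complementarity, semimonotonicity
    -- can then only select the index `i`.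
    obtain ⟨m, -, hmX, hmY, hcomp⟩ := exists_complementary hX hY (β : Set (Fin n))
      (Pi.single i ((X *ᵥ p) i)) 0 0
      (fun v hv _ => hX0 v (le_trans (Pi.single_nonneg.2 (hpX i).le) hv))
      (v₀ := p) (by
        intro j
        by_cases hj : j = i
        · subst hj; simp
        · simpa [hj] using (hpX j).le)
      (fun j hj => (hpY j hj).le)
    have hx : 0 ≤ X *ᵥ m := le_trans (Pi.single_nonneg.2 (hpX i).le) hmX
    have hxi : 0 < (X *ᵥ m) i := lt_of_lt_of_le (hpX i) (by simpa using hmX i)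
    obtain ⟨k, hk, hMk⟩ := hM (X *ᵥ m) (fun h => by simp [h] at hxi) hx
    rw [mulVec_mulVec, hXY] at hMk
    have hki : k = i := by
      by_contra hki
      rcases hcomp k with h | ⟨-, h⟩
      · simp [hki] at h; linarith
      · simp at h; linarith
    subst hki
    have hc : Continuous fun δ : ℝ => (Y *ᵥ (m + δ • p)) k := by
      simp only [mulVec_add, mulVec_smul, Pi.add_apply, Pi.smul_apply]
      fun_prop
    have he : ∀ᶠ δ in nhdsWithin (0 : ℝ) (Set.Ioi 0), 0 < (Y *ᵥ (m + δ • p)) k :=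
      ((hc.tendsto 0).eventually_const_lt (by simpa using hMk)).filter_mono nhdsWithin_le_nhds
    obtain ⟨δ, hδY, hδ⟩ := (he.and self_mem_nhdsWithin).exists
    have hδ : 0 < δ := hδ
    -- Adding a little of `p` makes the weak inequalities at `m` strict while row `i` of `Y` stays
    -- positive.
    refine ⟨m + δ • p, fun j => ?_, fun j hj => ?_⟩
    · simp only [mulVec_add, mulVec_smul, Pi.add_apply, Pi.smul_apply, smul_eq_mul]
      exact add_pos_of_nonneg_of_pos (hx j) (mul_pos hδ (hpX j))
    · rcases Finset.mem_insert.1 hj with rfl | hj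
      · exact hδY
      · simp only [mulVec_add, mulVec_smul, Pi.add_apply, Pi.smul_apply, smul_eq_mul]
        exact add_pos_of_nonneg_of_pos (hmY j hj) (mul_pos hδ (hpY j hj))

/-- Two `Z`-matrices with a common positivity vector have a common positive row at every vector
with a positive entry. -/
lemma exists_mulVec_pos_of_pos {X Y : Matrix (Fin n) (Fin n) ℝ} (hX : IsZMatrix X)
    (hY : IsZMatrix Y) {p : Fin n → ℝ} (hp : ∀ i, 0 < p i) (hXp : ∀ i, 0 < (X *ᵥ p) i)
    (hYp : ∀ i, 0 < (Y *ᵥ p) i) {v : Fin n → ℝ} {j : Fin n} (hj : 0 < v j) :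
    ∃ i, 0 < (X *ᵥ v) i ∧ 0 < (Y *ᵥ v) i := by
  obtain ⟨i, -, hi⟩ := Finset.exists_max_image Finset.univ (fun i => v i / p i)
    ⟨j, Finset.mem_univ j⟩
  have hθ : 0 < v i / p i := lt_of_lt_of_le (div_pos hj (hp j)) (hi j (Finset.mem_univ j))
  -- With the maximal ratio, `θ • p - v` is nonnegative and zero at `i`, so row `i` of `X` and `Y`
  -- is at least as large on `v` as on `θ • p`.
  set θ := v i / p i
  have hu : 0 ≤ θ • p - v := by
    intro k
    have := hi k (Finset.mem_univ k)
    rw [div_le_iff₀ (hp k)] at this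
    simpa using this
  have hui : (θ • p - v) i = 0 := by
    simp [θ, div_mul_cancel₀ _ (hp i).ne']
  have key : ∀ {Z : Matrix (Fin n) (Fin n) ℝ}, IsZMatrix Z → (∀ i, 0 < (Z *ᵥ p) i) →
      0 < (Z *ᵥ v) i := by
    intro Z hZ hZp
    have h := hZ.mulVec_nonpos hu hui
    simp [mulVec_sub, mulVec_smul] at h
    exact lt_of_lt_of_le (mul_pos hθ (hZp i)) h
  exact ⟨i, key hX hXp, key hY hYp⟩

/-- Strictly semimonotone hidden `Z`-matrices reverse the sign of no nonzero vector. -/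
lemma IsHiddenZ.eq_zero_of_mul_mulVec_nonpos {M : Matrix (Fin n) (Fin n) ℝ} (hZ : IsHiddenZ M)
    (hM : IsStrictE M) {x : Fin n → ℝ} (hx : ∀ i, x i * (M *ᵥ x) i ≤ 0) : x = 0 := by
  obtain ⟨X, Y, r, s, hX, hY, hr, hs, hXY, ht⟩ := hZ
  have hX0 : ∀ v, 0 ≤ X *ᵥ v → 0 ≤ v := fun v hv =>
    hM.nonneg_of_mulVec_nonneg hX hY hr hs hXY ht hv
  have hinj : Function.Injective X.mulVec := by
    intro u v huv
    have huv : X *ᵥ u = X *ᵥ v := huv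
    refine le_antisymm (sub_nonneg.1 (hX0 _ ?_)) (sub_nonneg.1 (hX0 _ ?_)) <;>
    simp [mulVec_sub, huv]
  have hsurj : Function.Surjective X.mulVec :=
    LinearMap.surjective_of_injective (f := X.mulVecLin) hinj
  obtain ⟨p, hXp, hYp⟩ := hM.exists_mulVec_pos hX hY hXY hsurj hX0 Finset.univ
  have hYp : ∀ i, 0 < (Y *ᵥ p) i := fun i => hYp i (Finset.mem_univ i)
  have hp0 : 0 ≤ p := hX0 p fun i => (hXp i).le
  have hp : ∀ i, 0 < p i := fun i => lt_of_le_of_ne (hp0 i) fun h =>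
    absurd (hXp i) (not_lt.2 (hX.mulVec_nonpos hp0 h.symm))
  obtain ⟨v, rfl⟩ := hsurj x
  have hx : ∀ i, (X *ᵥ v) i * (Y *ᵥ v) i ≤ 0 := by
    simpa only [mulVec_mulVec, hXY] using hx
  have hv : v = 0 := by
    funext j
    refine le_antisymm ?_ ?_
    · by_contra! hj
      obtain ⟨i, h1, h2⟩ := exists_mulVec_pos_of_pos hX hY hp hXp hYp hj
      exact absurd (mul_pos h1 h2) (not_lt.2 (hx i))
    · by_contra! hj
      obtain ⟨i, h1, h2⟩ := exists_mulVec_pos_of_pos hX hY hp hXp hYp (v := -v) (j := j)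
        (by simpa using hj)
      rw [mulVec_neg, Pi.neg_apply] at h1 h2
      have := mul_pos h1 h2
      rw [neg_mul_neg] at this
      exact absurd this (not_lt.2 (hx i))
  simp [hv]

lemma mul_eq_zero_of_mem_SOL {q : Fin n → ℝ} {A : Matrix (Fin n) (Fin n) ℝ} {z : Fin n → ℝ}
    (hz : z ∈ SOL q A) (i : Fin n) : z i * (q + A *ᵥ z) i = 0 :=
  (Finset.sum_eq_zero_iff_of_nonneg fun j _ => mul_nonneg (hz.1.1 j) (hz.1.2 j)).1 hz.2 i
    (Finset.mem_univ i)

/-- By complementarity, `(z - z')_i (w - w')_i = -z_i w'_i - z'_i w_i ≤ 0`. -/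
lemma IsHiddenZ.eq_of_mem_SOL {M : Matrix (Fin n) (Fin n) ℝ} (hZ : IsHiddenZ M)
    (hM : IsStrictE M) {q z z' : Fin n → ℝ} (hz : z ∈ SOL q M) (hz' : z' ∈ SOL q M) :
    z = z' := by
  refine sub_eq_zero.1 (hZ.eq_zero_of_mul_mulVec_nonpos hM fun i => ?_)
  have h1 := mul_eq_zero_of_mem_SOL hz i
  have h2 := mul_eq_zero_of_mem_SOL hz' i
  have h3 := mul_nonneg (hz.1.1 i) (hz'.1.2 i)
  have h4 := mul_nonneg (hz'.1.1 i) (hz.1.2 i)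
  simp only [mulVec_sub, Pi.add_apply, Pi.sub_apply] at *
  linarith

/-! ### Feasible bases and non-degeneracy -/

lemma linearIndepOn_col_iff {m k : Type*} [Fintype k] {C : Matrix m k ℝ} {T : Set k} :
    LinearIndepOn ℝ C.col T ↔ ∀ y, C *ᵥ y = 0 → (∀ j ∉ T, y j = 0) → y = 0 := by
  have hC : ∀ y : k → ℝ, C *ᵥ y = ∑ j, y j • C.col j := by
    intro y
    funext i
    simp [mulVec, dotProduct, mul_comm]
  have hl : ∀ l : k →₀ ℝ, Finsupp.linearCombination ℝ C.col l = C *ᵥ l := by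
    intro l
    rw [hC, Finsupp.linearCombination_apply, Finsupp.sum_fintype _ _ (by simp)]
  rw [linearIndepOn_iff]
  constructor
  · intro h y hy hT
    have := h (Finsupp.equivFunOnFinite.symm y)
      ((Finsupp.mem_supported' ℝ _).2 fun j hj => by simpa using hT j hj) (by rw [hl]; simpa)
    exact congrArg (fun l : k →₀ ℝ => (l : k → ℝ)) this
  · intro h l hls hl0
    rw [hl] at hl0
    exact DFunLike.coe_injective (h l hl0 ((Finsupp.mem_supported' ℝ _).1 hls))

/-- Carathéodory's reduction to a basic feasible solution. -/
lemma exists_nonneg_linearIndepOn_support {m k : Type*} [Fintype k] (C : Matrix m k ℝ)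
    (x : k → ℝ) (hx : 0 ≤ x) :
    ∃ x', 0 ≤ x' ∧ C *ᵥ x' = C *ᵥ x ∧ Function.support x' ⊆ Function.support x ∧
      LinearIndepOn ℝ C.col (Function.support x') := by
  induction hc : (Function.support x).ncard using Nat.strong_induction_on generalizing x with
  | _ c ih =>
  by_cases hli : LinearIndepOn ℝ C.col (Function.support x)
  · exact ⟨x, hx, rfl, subset_rfl, hli⟩
  obtain ⟨y, hy, hyx, j, hj⟩ : ∃ y, C *ᵥ y = 0 ∧ (∀ j ∉ Function.support x, y j = 0) ∧
      ∃ j, 0 < y j := by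
    rw [linearIndepOn_col_iff] at hli
    push Not at hli
    obtain ⟨y, hy, hyx, hy0⟩ := hli
    obtain ⟨j, hj⟩ := Function.ne_iff.1 hy0
    rcases lt_or_gt_of_ne hj with h | h
    · exact ⟨-y, by simp [mulVec_neg, hy], fun i hi => by simp [hyx i hi], j, by simpa using h⟩
    · exact ⟨y, hy, hyx, j, h⟩
  classical
  -- Ratio test: the minimal ratio is the longest step along `-y` that stays nonnegative, and it
  -- kills coordinate `i`.
  obtain ⟨i, hi, hmin⟩ := Finset.exists_min_image {i | 0 < y i} (fun i => x i / y i)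
    ⟨j, by simpa using hj⟩
  have hi : 0 < y i := by simpa using hi
  set θ := x i / y i with hθ
  have hθ0 : 0 ≤ θ := div_nonneg (hx i) hi.le
  have hx' : 0 ≤ x - θ • y := by
    intro l
    simp only [Pi.zero_apply, Pi.sub_apply, Pi.smul_apply, smul_eq_mul, sub_nonneg]
    by_cases hl : 0 < y l
    · exact (le_div_iff₀ hl).1 (hmin l (by simpa using hl))
    · exact (mul_nonpos_of_nonneg_of_nonpos hθ0 (not_lt.1 hl)).trans (hx l)
  have hsub : Function.support (x - θ • y) ⊆ Function.support x := by
    intro l hl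
    by_contra hxl
    apply hl
    have h1 : x l = 0 := by simpa using hxl
    simp [h1, hyx l hxl]
  have hss : Function.support (x - θ • y) ⊂ Function.support x := by
    refine (Set.ssubset_iff_of_subset hsub).2 ⟨i, ?_, ?_⟩
    · by_contra h
      exact hi.ne' (hyx i h)
    · simp [hθ, hi.ne']
  obtain ⟨x', h1, h2, h3, h4⟩ := ih _ (hc ▸ Set.ncard_lt_ncard hss) _ hx' rfl
  exact ⟨x', h1, by rw [h2, mulVec_sub, mulVec_smul, hy]; simp, h3.trans hsub, h4⟩

lemma IsBasis.ncard_eq {A : Matrix (Fin n) (Fin n) ℝ} {B : Set (Fin n ⊕ Fin n)}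
    (hB : IsBasis A B) : B.ncard = n := by
  have hli : LinearIndependent ℝ fun j : B => (slackMatrix A).col j := hB.1
  have b := Module.Basis.mk hli (by
    have := hB.2
    rw [Set.image_eq_range] at this
    exact this.ge)
  have := Module.finrank_eq_nat_card_basis b
  simpa [Set.ncard] using this.symm

/-- If all feasible bases are non-degenerate, then the support of a feasible point contains
a basis. -/
lemma exists_isBasis_subset_support {A : Matrix (Fin n) (Fin n) ℝ} {q : Fin n → ℝ}
    (hB : ∀ B, IsFeasibleBasis q A B → IsNondegenerateBasis q A B)
    {x : Fin n ⊕ Fin n → ℝ} (hx : 0 ≤ x) (hq : slackMatrix A *ᵥ x = q) :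
    ∃ B, IsBasis A B ∧ B ⊆ Function.support x := by
  obtain ⟨x', h0, hx', hsub, hli⟩ := exists_nonneg_linearIndepOn_support (slackMatrix A) x hx
  obtain ⟨B, -, hTB, hspan, hBli⟩ := exists_linearIndepOn_extension hli (Set.subset_univ _)
  have hbasis : IsBasis A B := by
    refine ⟨hBli, ?_⟩
    rw [eq_top_iff]
    intro v _
    have hsub : Set.range (slackMatrix A).col ⊆
        Submodule.span ℝ ((slackMatrix A).col '' B) := by simpa using hspan
    have hv : v = ∑ i, v i • (slackMatrix A).col (Sum.inl i) := by
      funext k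
      simp [slackMatrix, Matrix.one_apply]
    rw [hv]
    exact Submodule.sum_mem _ fun i _ => Submodule.smul_mem _ _ (hsub ⟨_, rfl⟩)
  have hoff : ∀ j ∉ B, x' j = 0 := fun j hj => by
    by_contra h
    exact hj (hTB h)
  obtain ⟨-, u, ⟨hu, huB⟩, hne⟩ := hB B ⟨hbasis, x', ⟨hx'.trans hq, hoff⟩, h0⟩
  have hux : u - x' = 0 := linearIndepOn_col_iff.1 hBli _
    (by rw [mulVec_sub, hu, hx', hq, sub_self])
    (fun j hj => by simp [huB j hj, hoff j hj])
  rw [sub_eq_zero] at hux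
  subst hux
  exact ⟨B, hbasis, fun j hj => hsub (hne j hj)⟩

lemma slackMatrix_mulVec_elim (A : Matrix (Fin n) (Fin n) ℝ) (w z : Fin n → ℝ) :
    slackMatrix A *ᵥ Sum.elim w z = w - A *ᵥ z := by
  rw [slackMatrix, fromCols_mulVec_sumElim, one_mulVec, neg_mulVec, sub_eq_add_neg]

/-- If all feasible bases are non-degenerate, then a solution is non-degenerate, and its
positive variables form a basis. -/
lemma isNondegenerateAt_of_mem_SOL {A : Matrix (Fin n) (Fin n) ℝ} {q z : Fin n → ℝ}
    (hB : ∀ B, IsFeasibleBasis q A B → IsNondegenerateBasis q A B) (hz : z ∈ SOL q A) :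
    IsNondegenerateAt q A z ∧
      ∀ y : Fin n → ℝ, (∀ i, z i = 0 → y i = 0) → (∀ i, z i ≠ 0 → (A *ᵥ y) i = 0) → y = 0 := by
  set w := q + A *ᵥ z with hw
  have hw0 : 0 ≤ w := hz.1.2
  have hcompl := mul_eq_zero_of_mem_SOL hz
  obtain ⟨B, hbasis, hBx⟩ := exists_isBasis_subset_support hB (x := Sum.elim w z)
    (by rintro (i | i); exacts [hw0 i, hz.1.1 i])
    (by rw [slackMatrix_mulVec_elim, hw, add_sub_cancel_right])
  -- `B` has `n` elements and, by complementarity, never both `w_i` and `z_i`; so it contains one of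
  -- them for every `i`.
  have hsurj := Set.surj_on_of_inj_on_of_ncard_le (s := B) (t := Set.univ)
    (fun j _ => Sum.elim id id j) (fun _ _ => trivial) (by
      have hne : ∀ i, Sum.inl i ∈ B → Sum.inr i ∈ B → False := fun i h1 h2 =>
        mul_ne_zero (hBx h2) (hBx h1) (hcompl i)
      rintro (i | i) (j | j) h1 h2 h
      · simpa using h
      · obtain rfl : i = j := h
        exact (hne _ h1 h2).elim
      · obtain rfl : i = j := h
        exact (hne _ h2 h1).elim
      · simpa using h) (by simp [hbasis.ncard_eq, Set.ncard_univ])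
  have hnd : ∀ i, Sum.inl i ∈ B ∨ Sum.inr i ∈ B := by
    intro i
    obtain ⟨j | j, hj, rfl⟩ := hsurj i trivial
    exacts [Or.inl hj, Or.inr hj]
  refine ⟨fun i => ?_, fun y hy hAy => ?_⟩
  · rcases hnd i with h | h
    · exact add_pos_of_nonneg_of_pos (hz.1.1 i) (lt_of_le_of_ne (hw0 i) (Ne.symm (hBx h)))
    · exact add_pos_of_pos_of_nonneg (lt_of_le_of_ne (hz.1.1 i) (Ne.symm (hBx h))) (hw0 i)
  · have h := linearIndepOn_col_iff.1 hbasis.1 (Sum.elim (A *ᵥ y) y)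
      (by rw [slackMatrix_mulVec_elim, sub_self]) (by
        rintro (i | i) hi
        · exact hAy i (hBx ((hnd i).resolve_left hi))
        · refine hy i ?_
          have h1 : w i ≠ 0 := hBx ((hnd i).resolve_right hi)
          exact (mul_eq_zero.1 (hcompl i)).resolve_right h1)
    funext i
    exact congrFun h (Sum.inr i)

/-! ### Perturbation of solutions and conclusion -/

/-- A non-degenerate solution with a nonsingular basis persists, with the same support, under
the perturbation `A + ε I`. -/
lemma eventually_exists_mem_SOL {A : Matrix (Fin n) (Fin n) ℝ} {q z : Fin n → ℝ}
    (hz : z ∈ SOL q A) (hnd : IsNondegenerateAt q A z)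
    (hinj : ∀ y : Fin n → ℝ,
      (∀ i, z i = 0 → y i = 0) → (∀ i, z i ≠ 0 → (A *ᵥ y) i = 0) → y = 0) :
    ∀ᶠ ε in nhdsWithin (0 : ℝ) (Set.Ioi 0),
      ∃ u ∈ SOL q (A + ε • 1), ∀ i, u i = 0 ↔ z i = 0 := by
  classical
  -- `D ε *ᵥ v = d` says `v_i = 0` off the support of `z` and `w_i = 0` on it. Cramer's rule makes
  -- its solution continuous at `0`.
  set D : ℝ → Matrix (Fin n) (Fin n) ℝ := fun ε => of fun i j =>
    if z i = 0 then (1 : Matrix (Fin n) (Fin n) ℝ) i j else (A + ε • 1) i j with hD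
  set d : Fin n → ℝ := fun i => if z i = 0 then 0 else -q i with hd
  have hDv : ∀ ε v i, (D ε *ᵥ v) i = if z i = 0 then v i else ((A + ε • 1) *ᵥ v) i := by
    intro ε v i
    by_cases h : z i = 0
    · have : (D ε *ᵥ v) i = ((1 : Matrix (Fin n) (Fin n) ℝ) *ᵥ v) i := by
        simp [mulVec, hD, h]
      rw [this, one_mulVec, if_pos h]
    · simp [mulVec, hD, h]
  have hDc : Continuous D := by
    refine continuous_matrix fun i j => ?_
    by_cases h : z i = 0
    · simp [hD, h, continuous_const]
    · simp only [hD, of_apply, if_neg h, Matrix.add_apply, Matrix.smul_apply]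
      fun_prop
  have hcompl := mul_eq_zero_of_mem_SOL hz
  have hDz : D 0 *ᵥ z = d := by
    funext i
    rw [hDv]
    by_cases h : z i = 0
    · simp [hd, h]
    · have := (mul_eq_zero.1 (hcompl i)).resolve_left h
      simp only [Pi.add_apply] at this
      simp [hd, h]
      linarith
  have hdet : (D 0).det ≠ 0 := by
    intro h
    obtain ⟨y, hy0, hy⟩ := exists_mulVec_eq_zero_iff.2 h
    refine hy0 (hinj y (fun i hi => ?_) fun i hi => ?_)
    · have := congrFun hy i
      rwa [hDv, if_pos hi] at this
    · have := congrFun hy i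
      rw [hDv, if_neg hi] at this
      simpa using this
  set u : ℝ → Fin n → ℝ := fun ε => (D ε).det⁻¹ • ((D ε).adjugate *ᵥ d) with hu
  have hDu : ∀ ε, (D ε).det ≠ 0 → D ε *ᵥ u ε = d := by
    intro ε h
    rw [hu, mulVec_smul, mulVec_mulVec, mul_adjugate, smul_mulVec, one_mulVec,
      inv_smul_smul₀ h]
  have hu0 : u 0 = z := by
    simp only [hu]
    rw [← hDz, mulVec_mulVec, adjugate_mul, smul_mulVec, one_mulVec, inv_smul_smul₀ hdet]
  have huc : ContinuousAt u 0 :=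
    (hDc.matrix_det.continuousAt.inv₀ hdet).smul
      (hDc.matrix_adjugate.matrix_mulVec continuous_const).continuousAt
  have hwc : ContinuousAt (fun ε => q + (A + ε • (1 : Matrix (Fin n) (Fin n) ℝ)) *ᵥ u ε) 0 := by
    have : (fun ε => q + (A + ε • (1 : Matrix (Fin n) (Fin n) ℝ)) *ᵥ u ε) =
        fun ε => q + (A *ᵥ u ε + ε • u ε) := by
      funext ε
      rw [add_mulVec, smul_mulVec, one_mulVec]
    rw [this]
    have h1 : ContinuousAt (fun ε => A *ᵥ u ε) 0 :=
      (show Continuous fun v => A *ᵥ v by fun_prop).continuousAt.comp huc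
    exact continuousAt_const.add (h1.add (continuousAt_id.smul huc))
  have hpos : ∀ᶠ ε in nhds (0 : ℝ), ∀ i, (z i ≠ 0 → 0 < u ε i) ∧
      (z i = 0 → 0 < (q + (A + ε • (1 : Matrix (Fin n) (Fin n) ℝ)) *ᵥ u ε) i) := by
    refine Filter.eventually_all.2 fun i => ?_
    by_cases h : z i = 0
    · have h1 := ((continuous_apply i).continuousAt.comp hwc).eventually_const_lt
        (u := 0) (by have := hnd i; simp only [Function.comp, hu0]; simpa [h] using this)
      filter_upwards [h1] with ε hε
      exact ⟨fun h' => (h' h).elim, fun _ => hε⟩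
    · have h1 := ((continuous_apply i).continuousAt.comp huc).eventually_const_lt
        (u := 0) (by
          simp only [Function.comp, hu0]
          exact lt_of_le_of_ne (hz.1.1 i) (Ne.symm h))
      filter_upwards [h1] with ε hε
      exact ⟨fun _ => hε, fun h' => (h h').elim⟩
  have hdete : ∀ᶠ ε in nhds (0 : ℝ), (D ε).det ≠ 0 :=
    hDc.matrix_det.continuousAt.eventually_ne hdet
  refine Filter.Eventually.filter_mono nhdsWithin_le_nhds ?_
  filter_upwards [hpos, hdete] with ε hε hdε
  have hzero : ∀ i, z i = 0 → u ε i = 0 := by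
    intro i hi
    have := congrFun (hDu ε hdε) i
    simpa only [hDv, hd, if_pos hi] using this
  have hwzero : ∀ i, z i ≠ 0 →
      (q + (A + ε • (1 : Matrix (Fin n) (Fin n) ℝ)) *ᵥ u ε) i = 0 := by
    intro i hi
    have := congrFun (hDu ε hdε) i
    rw [hDv, if_neg hi] at this
    simp only [hd, if_neg hi] at this
    rw [Pi.add_apply, this, add_neg_cancel]
  refine ⟨u ε, ⟨⟨fun i => ?_, fun i => ?_⟩, Finset.sum_eq_zero fun i _ => ?_⟩,
    fun i => ⟨fun h => ?_, hzero i⟩⟩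
  · by_cases h : z i = 0
    · exact (hzero i h).ge
    · exact ((hε i).1 h).le
  · by_cases h : z i = 0
    · exact ((hε i).2 h).le
    · exact (hwzero i h).ge
  · by_cases h : z i = 0
    · rw [hzero i h, zero_mul]
    · rw [hwzero i h, mul_zero]
  · by_contra hzi
    exact ((hε i).1 hzi).ne' h

end LCP

theorem mainTheorem4 {n : ℕ} (A : Matrix (Fin n) (Fin n) ℝ) (q : Fin n → ℝ)
    (hZ : LCP.IsHiddenZ A) (hE : LCP.IsE0 A)
    (hB : ∀ B : Set (Fin n ⊕ Fin n),
      LCP.IsFeasibleBasis q A B → LCP.IsNondegenerateBasis q A B)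
    (hsol : (LCP.SOL q A).Nonempty) :
    ∃ z, LCP.SOL q A = {z} ∧ LCP.IsNondegenerateAt q A z := by
  obtain ⟨z, hz⟩ := hsol
  obtain ⟨hnd, hinj⟩ := LCP.isNondegenerateAt_of_mem_SOL hB hz
  refine ⟨z, Set.eq_singleton_iff_unique_mem.2 ⟨hz, fun z' hz' => ?_⟩, hnd⟩
  obtain ⟨hnd', hinj'⟩ := LCP.isNondegenerateAt_of_mem_SOL hB hz'
  obtain ⟨ε, ⟨⟨hZε, u, hu, huz⟩, u', hu', huz'⟩, hε⟩ :=
    (((hZ.eventually_add_smul_one.and (LCP.eventually_exists_mem_SOL hz hnd hinj)).and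
      (LCP.eventually_exists_mem_SOL hz' hnd' hinj')).and self_mem_nhdsWithin).exists
  obtain rfl := hZε.eq_of_mem_SOL (hE.isStrictE_add_smul_one hε) hu hu'
  have hsupp : ∀ i, z' i = 0 ↔ z i = 0 := fun i => (huz' i).symm.trans (huz i)
  -- With equal supports, `z' - z` solves the homogeneous system of the basis of `z`.
  refine sub_eq_zero.1 (hinj _ (fun i hi => ?_) fun i hi => ?_)
  · rw [Pi.sub_apply, (hsupp i).2 hi, hi, sub_zero]
  · have h1 := (mul_eq_zero.1 (LCP.mul_eq_zero_of_mem_SOL hz i)).resolve_left hi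
    have h2 := (mul_eq_zero.1 (LCP.mul_eq_zero_of_mem_SOL hz' i)).resolve_left
      (mt (hsupp i).1 hi)
    rw [Pi.add_apply] at h1 h2
    rw [Matrix.mulVec_sub, Pi.sub_apply]
    linarith
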